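/- Let $n \geq 1$ be an integer and let $\mathcal{C}$ be an additive and idempotent complete category (not assumed to be small). A sequence of contravariant (or of covariant) additive functors from $\mathcal{C}$ to abelian groups is called exact if its evaluation at every object of $\mathcal{C}$ is an exact sequence of abelian groups. An $n$-kernel of a morphism $f : X \to Y$ is a sequence $X_n \xrightarrow{f_n} \cdots \xrightarrow{f_2} X_1 \xrightarrow{f_1} X$ such that $0 \to \mathcal{C}(-,X_n) \to \cdots \to \mathcal{C}(-,X_1) \to \mathcal{C}(-,X) \to \mathcal{C}(-,Y)$ is exact. Dually, an $n$-cokernel of $f$ is a sequence $Y \xrightarrow{g_1} Y_1 \xrightarrow{g_2} \cdots \xrightarrow{g_n} Y_n$ such that $0 \to \mathcal{C}(Y_n,-) \to \cdots \to \mathcal{C}(Y_1,-) \to \mathcal{C}(Y,-) \to \mathcal{C}(X,-)$ is exact. One says that $\mathcal{C}$ has $n$-kernels (has $n$-cokernels) if every morphism of $\mathcal{C}$ has an $n$-kernel (an $n$-cokernel). A pre-$n$-segment is a sequence $X_n \to \cdots \to X_1 \to X_0$ such that $0 \to \mathcal{C}(-,X_n) \to \cdots \to \mathcal{C}(-,X_1)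 \to \mathcal{C}(-,X_0)$ is exact, and a pre-$n$-cosegment is a sequence $Y_0 \to Y_1 \to \cdots \to Y_n$ such that $0 \to \mathcal{C}(Y_n,-) \to \cdots \to \mathcal{C}(Y_1,-) \to \mathcal{C}(Y_0,-)$ is exact. The category $\mathcal{C}$ is called $n$-abelian if it has $n$-kernels and $n$-cokernels and the following two conditions hold. (A2) For every monomorphism $f : X \to Y$ and every $n$-cokernel $Y \xrightarrow{g_1} Y_1 \to \cdots \xrightarrow{g_n} Y_n$ of $f$, the sequence $X \xrightarrow{f} Y \xrightarrow{g_1} \cdots \xrightarrow{g_{n-1}} Y_{n-1}$ (with $Y_0 = Y$) is an $n$-kernel of $g_n$. (A2$^{\mathrm{op}}$) For every epimorphism $f : X \to Y$ and every $n$-kernel $X_n \xrightarrow{f_n} \cdots \to X_1 \xrightarrow{f_1} X$ of $f$, the sequence $X_{n-1} \xrightarrow{f_{n-1}} \cdots \xrightarrow{f_1} X \xrightarrow{f} Y$ (with $X_0 = X$) is an $n$-cokernel of $f_n$. Theorem. The category $\mathcal{C}$ is $n$-abelian if and only if it satisfies the following four conditions: (A1) $\mathcal{C}$ has $n$-kernels;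 (A1$^{\mathrm{op}}$) $\mathcal{C}$ has $n$-cokernels; (A2$_f$) every pre-$n$-segment in $\mathcal{C}$ is an $n$-kernel of some morphism of $\mathcal{C}$; (A2$_f^{\mathrm{op}}$) every pre-$n$-cosegment in $\mathcal{C}$ is an $n$-cokernel of some morphism of $\mathcal{C}$. -/

import Mathlib

open CategoryTheory CategoryTheory.Limits

universe v u

/-!
A finite sequence of morphisms `X ⟶ ⋯ ⟶ Y` of a category is a `Quiver.Path X Y`; its number of
morphisms is `Quiver.Path.length`. `Path.cons p f` appends the morphism `f` at the right end of `p`.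
Exactness of sequences of functors with values in abelian groups is componentwise exactness.
-/

namespace HigherHomological

open Quiver (Path)

variable {C : Type u} [Category.{v} C] [Preadditive C]

/-- The sequence `C(-, X) ⟶ C(-, Y) ⟶ C(-, Z)` induced by `f` and `g` is exact. -/
def HomToExact {X Y Z : C} (f : X ⟶ Y) (g : Y ⟶ Z) : Prop :=
  ∀ W : C, Function.Exact (fun a : W ⟶ X => a ≫ f) (fun b : W ⟶ Y => b ≫ g)

/-- The sequence `C(Z, -) ⟶ C(Y, -) ⟶ C(X, -)` induced by `f` and `g` is exact. -/
def HomFromExact {X Y Z : C} (f : X ⟶ Y) (g : Y ⟶ Z) : Prop :=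
  ∀ W : C, Function.Exact (fun a : Z ⟶ W => g ≫ a) (fun b : Y ⟶ W => f ≫ b)

/-- The sequence `0 ⟶ C(-, X) ⟶ C(-, Y)` induced by `f` is exact. -/
def HomToInjective {X Y : C} (f : X ⟶ Y) : Prop :=
  ∀ W : C, Function.Injective (fun a : W ⟶ X => a ≫ f)

/-- The sequence `0 ⟶ C(Y, -) ⟶ C(X, -)` induced by `f` is exact. -/
def HomFromInjective {X Y : C} (f : X ⟶ Y) : Prop :=
  ∀ W : C, Function.Injective (fun a : Y ⟶ W => f ≫ a)

/-- For a sequence `X ⟶ ⋯ ⟶ Y` followed by `g : Y ⟶ Z`, the sequence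
`0 ⟶ C(-, X) ⟶ ⋯ ⟶ C(-, Y) ⟶ C(-, Z)` is exact at the term `C(-, Y)`. -/
def HomToExactAt {X : C} : {Y Z : C} → Path X Y → (Y ⟶ Z) → Prop
  | _, _, .nil, g => HomToInjective g
  | _, _, .cons _ f, g => HomToExact f g

/-- For a sequence `X_m ⟶ ⋯ ⟶ X_1 ⟶ X_0`, the sequence
`0 ⟶ C(-, X_m) ⟶ ⋯ ⟶ C(-, X_1) ⟶ C(-, X_0)` is exact. -/
def HomToLeftExact {X : C} : {Y : C} → Path X Y → Prop
  | _, .nil => True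
  | _, .cons p g => HomToLeftExact p ∧ HomToExactAt p g

/-- For a sequence `X ⟶ ⋯ ⟶ Y` followed by `g : Y ⟶ Z`, the sequence
`C(Z, -) ⟶ C(Y, -) ⟶ ⋯ ⟶ C(X, -)` is exact at the term `C(Y, -)`; no condition if the
sequence `X ⟶ ⋯ ⟶ Y` is empty, since then `C(Y, -)` is the last term. -/
def HomFromExactAt {X : C} : {Y Z : C} → Path X Y → (Y ⟶ Z) → Prop
  | _, _, .nil, _ => True
  | _, _, .cons _ f, g => HomFromExact f g

/-- For a sequence `Y_0 ⟶ Y_1 ⟶ ⋯ ⟶ Y_m`, the sequence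
`C(Y_m, -) ⟶ ⋯ ⟶ C(Y_1, -) ⟶ C(Y_0, -)` is exact (at its inner terms). -/
def HomFromInnerExact {X : C} : {Y : C} → Path X Y → Prop
  | _, .nil => True
  | _, .cons p g => HomFromInnerExact p ∧ HomFromExactAt p g

/-- For a sequence `Y_0 ⟶ Y_1 ⟶ ⋯ ⟶ Y_m`, the sequence
`0 ⟶ C(Y_m, -) ⟶ ⋯ ⟶ C(Y_1, -) ⟶ C(Y_0, -)` is exact. -/
def HomFromLeftExact {X : C} : {Y : C} → Path X Y → Prop
  | _, .nil => True
  | _, .cons p g => HomFromInnerExact (.cons p g) ∧ HomFromInjective g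

/-- The sequence `p`, say `X_m ⟶ ⋯ ⟶ X_0`, is a pre-`m`-segment: it consists of `m` morphisms and
`0 ⟶ C(-, X_m) ⟶ ⋯ ⟶ C(-, X_0)` is exact. -/
def IsPreSegment (m : ℕ) {X Y : C} (p : Path X Y) : Prop :=
  p.length = m ∧ HomToLeftExact p

/-- The sequence `p`, say `Y_0 ⟶ ⋯ ⟶ Y_m`, is a pre-`m`-cosegment: it consists of `m` morphisms and
`0 ⟶ C(Y_m, -) ⟶ ⋯ ⟶ C(Y_0, -)` is exact. -/
def IsPreCosegment (m : ℕ) {X Y : C} (p : Path X Y) : Prop :=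
  p.length = m ∧ HomFromLeftExact p

/-- The sequence `p`, say `X_n ⟶ ⋯ ⟶ X_1 ⟶ X`, is an `n`-kernel of `f : X ⟶ Y`: it consists of `n`
morphisms and `0 ⟶ C(-, X_n) ⟶ ⋯ ⟶ C(-, X_1) ⟶ C(-, X) ⟶ C(-, Y)` is exact. -/
def IsNKernel (n : ℕ) {X Y : C} (f : X ⟶ Y) {A : C} (p : Path A X) : Prop :=
  p.length = n ∧ HomToLeftExact (p.cons f)

/-- The sequence `q`, say `Y ⟶ Y_1 ⟶ ⋯ ⟶ Y_n`, is an `n`-cokernel of `f : X ⟶ Y`: it consists of `n`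
morphisms and `0 ⟶ C(Y_n, -) ⟶ ⋯ ⟶ C(Y_1, -) ⟶ C(Y, -) ⟶ C(X, -)` is exact. -/
def IsNCokernel (n : ℕ) {X Y : C} (f : X ⟶ Y) {B : C} (q : Path Y B) : Prop :=
  q.length = n ∧ HomFromLeftExact ((Quiver.Hom.toPath f).comp q)

variable (C)

/-- Every morphism has an `n`-kernel. -/
def HasNKernels (n : ℕ) : Prop :=
  ∀ ⦃X Y : C⦄ (f : X ⟶ Y), ∃ (A : C) (p : Path A X), IsNKernel n f p

/-- Every morphism has an `n`-cokernel. -/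
def HasNCokernels (n : ℕ) : Prop :=
  ∀ ⦃X Y : C⦄ (f : X ⟶ Y), ∃ (B : C) (q : Path Y B), IsNCokernel n f q

/-- `n`-abelian categories, for `n ≥ 1`: additive and idempotent complete categories that have
`n`-kernels and `n`-cokernels, such that every monomorphism is, together with all but the last
morphism of any of its `n`-cokernels, an `n`-kernel of that last morphism, and dually. -/
structure IsNAbelian (n : ℕ) : Prop where
  hasZeroObject : HasZeroObject C
  hasFiniteBiproducts : HasFiniteBiproducts C
  isIdempotentComplete : IsIdempotentComplete C
  hasNKernels : HasNKernels C n
  hasNCokernels : HasNCokernels C n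
  isNKernel_of_mono : ∀ ⦃X Y : C⦄ (f : X ⟶ Y), Mono f →
    ∀ ⦃Z B : C⦄ (q : Path Y Z) (g : Z ⟶ B), IsNCokernel n f (q.cons g) →
      IsNKernel n g ((Quiver.Hom.toPath f).comp q)
  isNCokernel_of_epi : ∀ ⦃X Y : C⦄ (f : X ⟶ Y), Epi f →
    ∀ ⦃A Z : C⦄ (g : A ⟶ Z) (p : Path Z X), IsNKernel n f ((Quiver.Hom.toPath g).comp p) →
      IsNCokernel n g (p.cons f)

end HigherHomological

namespace HigherHomological

open Quiver (Path)

/-! ### Weak kernels, weak cokernels and their opposites. -/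

section Morphisms

variable {C : Type u} [Category.{v} C]

/-! From `n`-abelian to (A2_f): in a pre-segment `X_n ⟶ ⋯ ⟶ X_0` only a morphism of which the last
map is a weak kernel is missing. The first map is a monomorphism, so by (A2) its `n`-cokernel `Y_1 ⟶
Y_2 ⟶ ⋯` continues it, exactly for both Hom functors. The weak cokernel property yields a comparison
map from this sequence to the segment. Its mapping cone, after cancelling the common terms, is `Y_1
⟶ Y_2 ⊞ X_{n-2} ⟶ ⋯ ⟶ Y_n ⊞ X_0`, a pre-segment one step shorter (`exists_isConeDifferential`). By
induction its last map is a weak kernel of some `g`, and restricting `g` to `X_0` gives the required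
morphism (`exists_homToExact_of_hasLeftResolution`).

Conversely, let `f` be a monomorphism with an `n`-cokernel. Exactness under `C(W, -)` spreads to the
right: a left exact initial piece, padded on the left by zero objects, is a pre-`n`-segment, so by
(A2_f) its last map is a weak kernel of something, hence of its weak cokernel, the next map
(`homToLeftExact_of_mono`). The dual statements follow by passing to `Cᵒᵖ`. -/

lemma homToInjective_iff_mono {X Y : C} (f : X ⟶ Y) : HomToInjective f ↔ Mono f :=
  ⟨fun h => ⟨fun _ _ e => h _ e⟩, fun _ _ _ _ e => (cancel_mono f).1 e⟩

lemma homFromInjective_iff_epi {X Y : C} (f : X ⟶ Y) : HomFromInjective f ↔ Epi f :=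
  ⟨fun h => ⟨fun _ _ e => h _ e⟩, fun _ _ _ _ e => (cancel_epi f).1 e⟩

lemma homToInjective_op_iff {X Y : C} (f : X ⟶ Y) :
    HomToInjective f.op ↔ HomFromInjective f := by
  rw [homToInjective_iff_mono, homFromInjective_iff_epi, op_mono_iff]

variable [Preadditive C]

lemma homToExact_iff {X Y Z : C} (f : X ⟶ Y) (g : Y ⟶ Z) :
    HomToExact f g ↔ f ≫ g = 0 ∧ ∀ ⦃W : C⦄ (b : W ⟶ Y), b ≫ g = 0 → ∃ a : W ⟶ X, a ≫ f = b := by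
  constructor
  · intro h
    exact ⟨(h X f).2 ⟨𝟙 X, Category.id_comp f⟩, fun W b hb => (h W b).1 hb⟩
  · rintro ⟨h₁, h₂⟩ W b
    refine ⟨fun hb => h₂ b hb, ?_⟩
    rintro ⟨a, rfl⟩
    simp [h₁]

lemma homFromExact_iff {X Y Z : C} (f : X ⟶ Y) (g : Y ⟶ Z) :
    HomFromExact f g ↔
      f ≫ g = 0 ∧ ∀ ⦃W : C⦄ (b : Y ⟶ W), f ≫ b = 0 → ∃ a : Z ⟶ W, g ≫ a = b := by
  constructor
  · intro h
    exact ⟨(h Z g).2 ⟨𝟙 Z, Category.comp_id g⟩, fun W b hb => (h W b).1 hb⟩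
  · rintro ⟨h₁, h₂⟩ W b
    refine ⟨fun hb => h₂ b hb, ?_⟩
    rintro ⟨a, rfl⟩
    simp [reassoc_of% h₁]

lemma homToExact_op_iff {X Y Z : C} (f : X ⟶ Y) (g : Y ⟶ Z) :
    HomToExact g.op f.op ↔ HomFromExact f g := by
  rw [homToExact_iff, homFromExact_iff]
  refine and_congr ⟨fun h => Quiver.Hom.op_inj h, fun h => Quiver.Hom.unop_inj h⟩ ⟨?_, ?_⟩
  · intro h W b hb
    obtain ⟨a, ha⟩ := h b.op (Quiver.Hom.unop_inj hb)
    exact ⟨a.unop, Quiver.Hom.op_inj ha⟩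
  · intro h W b hb
    obtain ⟨a, ha⟩ := h b.unop (Quiver.Hom.op_inj hb)
    exact ⟨a.op, Quiver.Hom.unop_inj ha⟩

lemma homFromExact_op_iff {X Y Z : C} (f : X ⟶ Y) (g : Y ⟶ Z) :
    HomFromExact g.op f.op ↔ HomToExact f g := by
  rw [homToExact_iff, homFromExact_iff]
  refine and_congr ⟨fun h => Quiver.Hom.op_inj h, fun h => Quiver.Hom.unop_inj h⟩ ⟨?_, ?_⟩
  · intro h W b hb
    obtain ⟨a, ha⟩ := h b.op (Quiver.Hom.unop_inj hb)
    exact ⟨a.unop, Quiver.Hom.op_inj ha⟩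
  · intro h W b hb
    obtain ⟨a, ha⟩ := h b.unop (Quiver.Hom.op_inj hb)
    exact ⟨a.op, Quiver.Hom.unop_inj ha⟩

/-- If `f` is a weak kernel of some morphism, it is a weak kernel of each of its weak cokernels. -/
lemma HomToExact.of_homFromExact {X Y Z Z' : C} {f : X ⟶ Y} {g : Y ⟶ Z} {g' : Y ⟶ Z'}
    (h : HomToExact f g) (h' : HomFromExact f g') : HomToExact f g' := by
  rw [homToExact_iff] at h ⊢
  rw [homFromExact_iff] at h'
  obtain ⟨s, hs⟩ := h'.2 g h.1
  refine ⟨h'.1, fun W b hb => h.2 b ?_⟩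
  rw [← hs, ← Category.assoc, hb, zero_comp]

/-! ### Shortening a resolution by a mapping cone. -/

/-- The functor presented by `x` has a resolution by representables of length `k`: there is an exact
sequence `0 ⟶ C(-, X_k) ⟶ ⋯ ⟶ C(-, X_1) ⟶ C(-, X_0)` whose last morphism is induced by `x`. -/
def HasLeftResolution : ℕ → ∀ {X Y : C}, (X ⟶ Y) → Prop
  | 0, _, _, _ => False
  | 1, _, _, x => HomToInjective x
  | k + 2, X, _, x => ∃ (W : C) (x' : W ⟶ X), HasLeftResolution (k + 1) x' ∧ HomToExact x' x

/-- The morphism `y` can be continued to the right by `j` morphisms, such that the sequence is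
exact, at all its inner terms, both under `C(W, -)` and under `C(-, W)`. -/
def HasBiexactContinuation : ℕ → ∀ {X Y : C}, (X ⟶ Y) → Prop
  | 0, _, _, _ => True
  | j + 1, _, Y, y => ∃ (Z : C) (y' : Y ⟶ Z),
      HomToExact y y' ∧ HomFromExact y y' ∧ HasBiexactContinuation j y'

/-- The last differential `c` of the mapping cone of a morphism of sequences from
`⋯ ⟶ Y ⟶ Y'` to `⋯ ⟶ X₁ ⟶ X₀` with component `φ : Y ⟶ X₀`, with the properties that allow one to
compare `x` with `c` and to continue the cone to the right. -/
structure IsConeDifferential {X₁ X₀ Y Y' Z : C} (x : X₁ ⟶ X₀) (y : Y ⟶ Y') (φ : Y ⟶ X₀)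
    (c₁ : Z ⟶ Y') (c₂ : Z ⟶ X₀) : Prop where
  exists_extension : ∀ ⦃T : C⦄ (t : X₀ ⟶ T), x ≫ t = 0 → ∃ s : Y' ⟶ T, y ≫ s = φ ≫ t
  exists_lift : ∀ ⦃W : C⦄ (w : W ⟶ Y) (v : W ⟶ X₁),
    ∃ e : W ⟶ Z, e ≫ c₁ = w ≫ y ∧ e ≫ c₂ = w ≫ φ + v ≫ x
  comp_eq : ∀ ⦃T : C⦄ (t : X₀ ⟶ T) (s : Y' ⟶ T), x ≫ t = 0 → y ≫ s = φ ≫ t → c₁ ≫ s = c₂ ≫ t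
  exists_factor : ∀ ⦃W : C⦄ (e : W ⟶ Z), e ≫ c₁ = 0 → ∃ v : W ⟶ X₁, e ≫ c₂ = v ≫ x

variable [HasBinaryBiproducts C]

/-- The cone is built from left to right, one term per step of the induction. The parameter `j`
counts the maps of the continuation not yet used; each step consumes one. -/
lemma exists_isConeDifferential (k : ℕ) : ∀ (j : ℕ),
    (∀ ⦃X Y : C⦄ (f : X ⟶ Y), Mono f → HasBiexactContinuation (k + 2 + j) f) →
    ∀ {X₁ X₀ : C} (x : X₁ ⟶ X₀), HasLeftResolution (k + 2) x →
      ∃ (Y Y' Z : C) (y : Y ⟶ Y') (φ : Y ⟶ X₀) (c₁ : Z ⟶ Y') (c₂ : Z ⟶ X₀),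
        IsConeDifferential x y φ c₁ c₂ ∧ HasBiexactContinuation j y ∧
          HasLeftResolution (k + 1) (biprod.lift c₁ c₂) := by
  induction k with
  | zero =>
    rintro j H X₁ X₀ x ⟨X₂, x₂, hx₂, hx⟩
    have hx₂' : HomToInjective x₂ := hx₂
    rw [homToInjective_iff_mono] at hx₂'
    rw [show 0 + 2 + j = (j + 1) + 1 by omega] at H
    obtain ⟨Y₁, y₁, h₁, h₁', Y₂, y₂, h₂, h₂', hj⟩ := H x₂ hx₂'
    rw [homToExact_iff] at hx h₁ h₂
    rw [homFromExact_iff] at h₁' h₂'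
    obtain ⟨φ, hφ⟩ := h₁'.2 x hx.1
    -- The comparison is the identity on `X₂` and `X₁`; these terms cancel, so the cone starts at
    -- `Y₁` and not at `Y₁ ⊞ X₁`.
    refine ⟨Y₁, Y₂, Y₁, y₂, φ, y₂, φ, ⟨?_, ?_, ?_, ?_⟩, hj, ?_⟩
    · intro T t ht
      exact h₂'.2 _ (by rw [← Category.assoc, hφ, ht])
    · intro W w v
      exact ⟨w + v ≫ y₁, by simp [h₂.1], by simp [hφ]⟩
    · intro T t s _ h
      exact h
    · intro W e he
      obtain ⟨v, rfl⟩ := h₂.2 e he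
      exact ⟨v, by simp [hφ]⟩
    · refine (homToInjective_iff_mono _).2 (Preadditive.mono_of_cancel_zero _ fun e he => ?_)
      have he₁ : e ≫ y₂ = 0 := by simpa using he =≫ biprod.fst
      have he₂ : e ≫ φ = 0 := by simpa using he =≫ biprod.snd
      obtain ⟨v, rfl⟩ := h₂.2 e he₁
      rw [Category.assoc, hφ] at he₂
      obtain ⟨u, rfl⟩ := hx.2 v he₂
      simp [h₁.1]
  | succ k ih =>
    rintro j H X₀ X' x' ⟨X₁, x, hx, hxx'⟩
    rw [show k + 1 + 2 + j = k + 2 + (j + 1) by omega] at H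
    obtain ⟨Y, Y', Z, y, φ, c₁, c₂, hc, ⟨Y'', y', hy, hy', hj⟩, hres⟩ := ih (j + 1) H x hx
    rw [homToExact_iff] at hxx' hy
    rw [homFromExact_iff] at hy'
    obtain ⟨φ', hφ'⟩ := hc.exists_extension x' hxx'.1
    refine ⟨Y', Y'', Y' ⊞ X₀, y', φ', biprod.fst ≫ y', biprod.fst ≫ φ' - biprod.snd ≫ x',
      ⟨?_, ?_, ?_, ?_⟩, hj, Z, biprod.lift c₁ c₂, hres, ?_⟩
    · intro T t ht
      exact hy'.2 _ (by rw [← Category.assoc, hφ', Category.assoc, ht, comp_zero])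
    · intro W w v
      exact ⟨biprod.lift w (-v), by simp, by simp⟩
    · intro T t s ht hs
      simp [hs, ht, Preadditive.sub_comp]
    · intro W e he
      obtain ⟨w, hw⟩ := hy.2 (e ≫ biprod.fst) (by simpa using he)
      refine ⟨w ≫ φ - e ≫ biprod.snd, ?_⟩
      rw [Preadditive.comp_sub, ← Category.assoc, ← hw, Preadditive.sub_comp]
      simp [hφ']
    · rw [homToExact_iff]
      refine ⟨?_, fun W b hb => ?_⟩
      · have h₁ : c₁ ≫ y' = 0 := by
          simpa using hc.comp_eq (0 : X₀ ⟶ Y'') y' (by simp) (by simp [hy.1])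
        have h₂ := hc.comp_eq x' φ' hxx'.1 hφ'
        ext <;> simp [h₁, h₂]
      · have hb₁ : (b ≫ biprod.fst) ≫ y' = 0 := by simpa using hb =≫ biprod.fst
        have hb₂ : (b ≫ biprod.fst) ≫ φ' = (b ≫ biprod.snd) ≫ x' := by
          simpa [sub_eq_zero] using hb =≫ biprod.snd
        obtain ⟨w, hw⟩ := hy.2 _ hb₁
        rw [← hw, Category.assoc, hφ'] at hb₂
        -- Once the `Y'`-component is lifted to `w`, the error in the `X₀`-component is killed by
        -- `x'`, so it comes from `X₁`.
        obtain ⟨v, hv⟩ := hxx'.2 (b ≫ biprod.snd - w ≫ φ) (by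
          rw [Preadditive.sub_comp, ← hb₂, Category.assoc, sub_self])
        obtain ⟨e, he₁, he₂⟩ := hc.exists_lift w v
        refine ⟨e, ?_⟩
        ext
        · simp [he₁, hw]
        · simp [he₂, hv]

/-- The cone trades one step of resolution for one spare map of the continuation, which is why `j`
must vary in the induction. -/
lemma exists_homToExact_of_hasLeftResolution (k : ℕ) : ∀ (j : ℕ),
    (∀ ⦃X Y : C⦄ (f : X ⟶ Y), Mono f → HasBiexactContinuation (k + 1 + j) f) →
    ∀ {X₁ X₀ : C} (x : X₁ ⟶ X₀), HasLeftResolution (k + 1) x →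
      ∃ (T : C) (f : X₀ ⟶ T), HomToExact x f := by
  induction k with
  | zero =>
    intro j H X₁ X₀ x hx
    rw [show 0 + 1 + j = j + 1 by omega] at H
    obtain ⟨T, f, hf, -⟩ := H x ((homToInjective_iff_mono x).1 hx)
    exact ⟨T, f, hf⟩
  | succ k ih =>
    intro j H X₁ X₀ x hx
    obtain ⟨Y, Y', Z, y, φ, c₁, c₂, hc, -, hres⟩ := exists_isConeDifferential k j H x hx
    rw [show k + 1 + 1 + j = k + 1 + (j + 1) by omega] at H
    obtain ⟨T, g, hg⟩ := ih (j + 1) H _ hres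
    rw [homToExact_iff] at hg
    refine ⟨T, biprod.inr ≫ g, (homToExact_iff _ _).2 ⟨?_, fun W b hb => ?_⟩⟩
    · obtain ⟨e, he₁, he₂⟩ := hc.exists_lift (0 : X₁ ⟶ Y) (𝟙 X₁)
      have h : x ≫ biprod.inr = e ≫ biprod.lift c₁ c₂ := by
        ext
        · simp [he₁]
        · simp [he₂]
      rw [← Category.assoc, h, Category.assoc, hg.1, comp_zero]
    · obtain ⟨e, he⟩ := hg.2 (b ≫ biprod.inr) (by simpa using hb)
      obtain ⟨v, hv⟩ := hc.exists_factor e (by simpa using he =≫ biprod.fst)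
      refine ⟨v, ?_⟩
      rw [← hv]
      simpa using he =≫ biprod.snd

end Morphisms

/-! ### Sequences: building `n`-kernels, and extending exactness to the right. -/

section Paths

variable {C : Type u} [Category.{v} C] [Preadditive C]

lemma hasLeftResolution_of_homToLeftExact {A : C} : ∀ {X Y : C} (p : Path A X) (x : X ⟶ Y),
    HomToLeftExact (p.cons x) → HasLeftResolution (p.length + 1) x
  | _, _, .nil, _, h => h.2
  | _, _, .cons p x', _, h => ⟨_, x', hasLeftResolution_of_homToLeftExact p x' h.1, h.2⟩

/-- The condition `HasBiexactContinuation` for the last morphism of the sequence `f, q`. -/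
def HasBiexactContinuationOfLast (j : ℕ) {X Y : C} (f : X ⟶ Y) : {Z : C} → Path Y Z → Prop
  | _, .nil => HasBiexactContinuation j f
  | _, .cons _ g => HasBiexactContinuation j g

/-- Paths unfold from the right, continuations from the left; the accumulator `j` counts the maps
already removed from the right end. -/
lemma hasBiexactContinuation_of_last {X Y : C} (f : X ⟶ Y) : ∀ {Z : C} (q : Path Y Z) (j : ℕ),
    HomToLeftExact ((Quiver.Hom.toPath f).comp q) →
    HomFromInnerExact ((Quiver.Hom.toPath f).comp q) →
    HasBiexactContinuationOfLast j f q → HasBiexactContinuation (q.length + j) f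
  | _, .nil, j, _, _, h => by
    rw [Path.length_nil, Nat.zero_add]
    exact h
  | _, .cons .nil g, j, h₁, h₂, h => by
    rw [show (Path.cons Path.nil g).length + j = j + 1 by simp [Nat.add_comm]]
    exact ⟨_, g, h₁.2, h₂.2, h⟩
  | _, .cons (.cons q g') g, j, h₁, h₂, h => by
    have := hasBiexactContinuation_of_last f (q.cons g') (j + 1) h₁.1 h₂.1 ⟨_, g, h₁.2, h₂.2, h⟩
    rwa [show ((q.cons g').cons g).length + j = (q.cons g').length + (j + 1) by
      simp only [Path.length_cons]; omega]

lemma hasBiexactContinuation_of_exact {X Y Z : C} (f : X ⟶ Y) (q : Path Y Z)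
    (h₁ : HomToLeftExact ((Quiver.Hom.toPath f).comp q))
    (h₂ : HomFromInnerExact ((Quiver.Hom.toPath f).comp q)) :
    HasBiexactContinuation q.length f :=
  hasBiexactContinuation_of_last f q 0 h₁ h₂ (by cases q <;> exact trivial)

lemma HomFromLeftExact.homFromInnerExact {X Y : C} {p : Path X Y} (h : HomFromLeftExact p) :
    HomFromInnerExact p := by
  cases p with
  | nil => trivial
  | cons p g => exact h.1

lemma exists_isNKernel_of_isPreSegment [HasBinaryBiproducts C] (n : ℕ)
    (H : ∀ ⦃X Y : C⦄ (f : X ⟶ Y), Mono f → HasBiexactContinuation n f)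
    {A X : C} (p : Path A X) (hp : IsPreSegment n p) :
    ∃ (Y : C) (f : X ⟶ Y), IsNKernel n f p := by
  obtain ⟨hl, hp⟩ := hp
  cases p with
  | nil =>
    exact ⟨A, 𝟙 A, hl, trivial, (homToInjective_iff_mono _).2 inferInstance⟩
  | cons p x =>
    obtain rfl : p.length + 1 = n := hl
    obtain ⟨Y, f, hf⟩ := exists_homToExact_of_hasLeftResolution p.length 0 H x
      (hasLeftResolution_of_homToLeftExact p x hp)
    exact ⟨Y, f, rfl, hp, hf⟩

/-- A morphism out of `A` is a monomorphism exactly when `0 ⟶ A` is a weak kernel of it; no other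
condition changes. -/
lemma homToLeftExact_zero_comp_iff {Z A : C} (hZ : IsZero Z) : ∀ {X : C} (p : Path A X),
    HomToLeftExact ((Quiver.Hom.toPath (0 : Z ⟶ A)).comp p) ↔ HomToLeftExact p
  | _, .nil => ⟨fun _ => trivial, fun _ => ⟨trivial, fun _ _ _ _ => hZ.eq_of_tgt _ _⟩⟩
  | _, .cons .nil g => by
    refine and_congr (homToLeftExact_zero_comp_iff hZ .nil) ?_
    change HomToExact (0 : Z ⟶ A) g ↔ HomToInjective g
    rw [homToInjective_iff_mono, homToExact_iff]
    constructor
    · rintro ⟨-, h⟩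
      refine Preadditive.mono_of_cancel_zero _ fun b hb => ?_
      obtain ⟨a, rfl⟩ := h b hb
      simp
    · intro _
      refine ⟨zero_comp, fun W b hb => ⟨0, ?_⟩⟩
      rw [zero_comp, (cancel_mono g).1 (hb.trans zero_comp.symm)]
  | _, .cons (.cons p h) g =>
    and_congr (homToLeftExact_zero_comp_iff hZ (p.cons h)) Iff.rfl

/-- If pre-`n`-segments are `n`-kernels, then shorter pre-segments also extend to the right. -/
lemma exists_homToLeftExact_cons [HasZeroObject C] (n : ℕ)
    (H : ∀ (A X : C) (p : Path A X), IsPreSegment n p → ∃ (Y : C) (f : X ⟶ Y), IsNKernel n f p)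
    (j : ℕ) : ∀ {A X : C} (p : Path A X), p.length + j = n → HomToLeftExact p →
      ∃ (Y : C) (f : X ⟶ Y), HomToLeftExact (p.cons f) := by
  induction j with
  | zero =>
    intro A X p hl hp
    obtain ⟨Y, f, hf⟩ := H A X p ⟨hl, hp⟩
    exact ⟨Y, f, hf.2⟩
  | succ j ih =>
    intro A X p hl hp
    obtain ⟨Z, hZ⟩ := HasZeroObject.zero (C := C)
    obtain ⟨Y, f, hf⟩ := ih ((Quiver.Hom.toPath (0 : Z ⟶ A)).comp p)
      (by simp only [Path.length_comp, Path.length_toPath]; omega)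
      ((homToLeftExact_zero_comp_iff hZ p).2 hp)
    exact ⟨Y, f, (homToLeftExact_zero_comp_iff hZ (p.cons f)).1 hf⟩

/-- Induction on `q`: the part already known to be left exact has at most `n` maps, so its last map
is a weak kernel of some `t`, hence also of its weak cokernel `g`. -/
lemma homToLeftExact_of_mono [HasZeroObject C] (n : ℕ)
    (H : ∀ (A X : C) (p : Path A X), IsPreSegment n p → ∃ (Y : C) (f : X ⟶ Y), IsNKernel n f p)
    {X Y : C} (f : X ⟶ Y) (hf : Mono f) : ∀ {Z : C} (q : Path Y Z), q.length ≤ n →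
      HomFromInnerExact ((Quiver.Hom.toPath f).comp q) →
      HomToLeftExact ((Quiver.Hom.toPath f).comp q)
  | _, .nil, _, _ => ⟨trivial, (homToInjective_iff_mono f).2 hf⟩
  | _, .cons .nil g, hl, hq => by
    have hp := homToLeftExact_of_mono n H f hf .nil (Nat.zero_le n) hq.1
    obtain ⟨T, t, ht⟩ := exists_homToLeftExact_cons n H (n - 1) _
      (by simp only [Path.length_comp, Path.length_toPath, Path.length_cons, Path.length_nil]
            at hl ⊢; omega) hp
    exact ⟨hp, HomToExact.of_homFromExact ht.2 hq.2⟩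
  | _, .cons (.cons q h) g, hl, hq => by
    rw [Path.length_cons] at hl
    have hp := homToLeftExact_of_mono n H f hf (q.cons h) (by omega) hq.1
    obtain ⟨T, t, ht⟩ := exists_homToLeftExact_cons n H (n - (q.cons h).length - 1) _
      (by simp only [Path.length_comp, Path.length_toPath]; omega) hp
    exact ⟨hp, HomToExact.of_homFromExact ht.2 hq.2⟩

end Paths

/-! ### Duality: reversing sequences. -/

section Opposite

variable {C : Type u} [Category.{v} C]

/-- The sequence of the opposite category formed by the opposites of the morphisms of `p`. -/
def opPath {X : C} : {Y : C} → Path X Y → Path (Opposite.op Y) (Opposite.op X)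
  | _, .nil => .nil
  | _, .cons p f => (Quiver.Hom.toPath f.op).comp (opPath p)

lemma opPath_toPath_comp {W X : C} (f : W ⟶ X) : ∀ {Y : C} (p : Path X Y),
    opPath ((Quiver.Hom.toPath f).comp p) = (opPath p).cons f.op
  | _, .nil => rfl
  | _, .cons p g => by
    change (Quiver.Hom.toPath g.op).comp (opPath ((Quiver.Hom.toPath f).comp p)) = _
    rw [opPath_toPath_comp f p]
    rfl

lemma length_opPath {X : C} : ∀ {Y : C} (p : Path X Y), (opPath p).length = p.length
  | _, .nil => rfl
  | _, .cons p f => by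
    rw [opPath, Path.length_comp, length_opPath p, Path.length_toPath, Path.length_cons,
      Nat.add_comm]

lemma exists_opPath_eq {X : Cᵒᵖ} : ∀ {Y : Cᵒᵖ} (p : Path X Y),
    ∃ q : Path Y.unop X.unop, opPath q = p
  | _, .nil => ⟨.nil, rfl⟩
  | _, .cons p f => by
    obtain ⟨q, rfl⟩ := exists_opPath_eq p
    exact ⟨(Quiver.Hom.toPath f.unop).comp q, opPath_toPath_comp f.unop q⟩

variable [Preadditive C]

/-- For a sequence `X ⟶ ⋯ ⟶ Y` followed by `g : Y ⟶ Z`, the sequence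
`C(-, X) ⟶ ⋯ ⟶ C(-, Y) ⟶ C(-, Z)` is exact at `C(-, Y)`, if this is an inner term. -/
def HomToInnerExactAt {X : C} : {Y Z : C} → Path X Y → (Y ⟶ Z) → Prop
  | _, _, .nil, _ => True
  | _, _, .cons _ f, g => HomToExact f g

/-- For a sequence `X_m ⟶ ⋯ ⟶ X_0`, the sequence `C(-, X_m) ⟶ ⋯ ⟶ C(-, X_0)` is exact at its
inner terms. -/
def HomToInnerExact {X : C} : {Y : C} → Path X Y → Prop
  | _, .nil => True
  | _, .cons p g => HomToInnerExact p ∧ HomToInnerExactAt p g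

/-- Exactness is defined by recursion on the last arrow, but reversal turns that arrow into the
first one; this and the next two lemmas split off the condition at the left end. -/
lemma homToLeftExact_toPath_comp_iff {W X : C} (f : W ⟶ X) : ∀ {Y : C} (p : Path X Y),
    HomToLeftExact ((Quiver.Hom.toPath f).comp p) ↔
      HomToInnerExact ((Quiver.Hom.toPath f).comp p) ∧ HomToInjective f
  | _, .nil => ⟨fun h => ⟨⟨trivial, trivial⟩, h.2⟩, fun h => ⟨trivial, h.2⟩⟩
  | _, .cons .nil _ => (and_congr_left' (homToLeftExact_toPath_comp_iff f .nil)).trans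
      and_right_comm
  | _, .cons (.cons p h) _ =>
    (and_congr_left' (homToLeftExact_toPath_comp_iff f (p.cons h))).trans and_right_comm

lemma homToInnerExact_toPath_comp_iff {V W X : C} (e : V ⟶ W) (f : W ⟶ X) :
    ∀ {Y : C} (p : Path X Y),
      HomToInnerExact ((Quiver.Hom.toPath e).comp ((Quiver.Hom.toPath f).comp p)) ↔
        HomToInnerExact ((Quiver.Hom.toPath f).comp p) ∧ HomToExact e f
  | _, .nil => ⟨fun h => ⟨⟨trivial, trivial⟩, h.2⟩, fun h => ⟨⟨trivial, trivial⟩, h.2⟩⟩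
  | _, .cons .nil _ => (and_congr_left' (homToInnerExact_toPath_comp_iff e f .nil)).trans
      and_right_comm
  | _, .cons (.cons p h) _ =>
    (and_congr_left' (homToInnerExact_toPath_comp_iff e f (p.cons h))).trans and_right_comm

lemma homFromInnerExact_toPath_comp_iff {V W X : C} (e : V ⟶ W) (f : W ⟶ X) :
    ∀ {Y : C} (p : Path X Y),
      HomFromInnerExact ((Quiver.Hom.toPath e).comp ((Quiver.Hom.toPath f).comp p)) ↔
        HomFromInnerExact ((Quiver.Hom.toPath f).comp p) ∧ HomFromExact e f
  | _, .nil => ⟨fun h => ⟨⟨trivial, trivial⟩, h.2⟩, fun h => ⟨⟨trivial, trivial⟩, h.2⟩⟩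
  | _, .cons .nil _ => (and_congr_left' (homFromInnerExact_toPath_comp_iff e f .nil)).trans
      and_right_comm
  | _, .cons (.cons p h) _ =>
    (and_congr_left' (homFromInnerExact_toPath_comp_iff e f (p.cons h))).trans and_right_comm

lemma homToInnerExact_opPath_iff {X : C} : ∀ {Y : C} (p : Path X Y),
    HomToInnerExact (opPath p) ↔ HomFromInnerExact p
  | _, .nil => Iff.rfl
  | _, .cons .nil _ => Iff.rfl
  | _, .cons (.cons p f) g =>
    (homToInnerExact_toPath_comp_iff g.op f.op (opPath p)).trans
      (and_congr (homToInnerExact_opPath_iff (p.cons f)) (homToExact_op_iff f g))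

lemma homToLeftExact_opPath_iff {X Y : C} (p : Path X Y) :
    HomToLeftExact (opPath p) ↔ HomFromLeftExact p := by
  cases p with
  | nil => exact Iff.rfl
  | cons p f =>
    exact (homToLeftExact_toPath_comp_iff f.op (opPath p)).trans
      (and_congr (homToInnerExact_opPath_iff (p.cons f)) (homToInjective_op_iff f))

lemma homFromInnerExact_opPath {X : C} : ∀ {Y : C} (p : Path X Y),
    HomToLeftExact p → HomFromInnerExact (opPath p)
  | _, .nil, _ => trivial
  | _, .cons .nil _, _ => ⟨trivial, trivial⟩
  | _, .cons (.cons p f) g, h =>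
    (homFromInnerExact_toPath_comp_iff g.op f.op (opPath p)).2
      ⟨homFromInnerExact_opPath (p.cons f) h.1, (homFromExact_op_iff f g).2 h.2⟩

end Opposite

/-! ### Both implications, in `C` and in `Cᵒᵖ`. -/

section Main

variable {C : Type u} [Category.{v} C]

lemma exists_eq_toPath_comp {X Y : C} : ∀ (p : Path X Y), 1 ≤ p.length →
    ∃ (Z : C) (f : X ⟶ Z) (q : Path Z Y), p = (Quiver.Hom.toPath f).comp q
  | .cons .nil f, _ => ⟨_, f, .nil, rfl⟩
  | .cons (.cons p f) g, _ => by
    obtain ⟨Z, e, q, hq⟩ := exists_eq_toPath_comp (p.cons f) (by simp)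
    exact ⟨Z, e, q.cons g, by rw [hq]; rfl⟩

variable [Preadditive C]

lemma IsNAbelian.hasBiexactContinuation {n : ℕ} (hn : 1 ≤ n) (h : IsNAbelian C n) {X Y : C}
    (f : X ⟶ Y) (hf : Mono f) : HasBiexactContinuation n f := by
  obtain ⟨B, q, hq⟩ := h.hasNCokernels f
  cases q with
  | nil => exact absurd hq.1 (by simp; omega)
  | cons q g =>
    have := hasBiexactContinuation_of_exact f (q.cons g) (h.isNKernel_of_mono f hf q g hq).2
      hq.2.homFromInnerExact
    rwa [hq.1] at this

lemma IsNAbelian.hasBiexactContinuation_op {n : ℕ} (hn : 1 ≤ n) (h : IsNAbelian C n) {X Y : Cᵒᵖ}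
    (f : X ⟶ Y) (hf : Mono f) : HasBiexactContinuation n f := by
  obtain ⟨A, p, hp⟩ := h.hasNKernels f.unop
  obtain ⟨Z, g, q, rfl⟩ := exists_eq_toPath_comp p (by rw [hp.1]; exact hn)
  have hc := h.isNCokernel_of_epi f.unop inferInstance g q hp
  have := hasBiexactContinuation_of_exact f (opPath ((Quiver.Hom.toPath g).comp q))
    ((homToLeftExact_opPath_iff (((Quiver.Hom.toPath g).comp q).cons f.unop)).2 hc.2)
    (homFromInnerExact_opPath (((Quiver.Hom.toPath g).comp q).cons f.unop) hp.2)
  rwa [length_opPath, hp.1] at this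

/-- If pre-`n`-cosegments of `C` are `n`-cokernels, then pre-`n`-segments of `Cᵒᵖ` are
`n`-kernels. -/
lemma exists_isNKernel_op {n : ℕ}
    (H : ∀ (Y B : C) (q : Path Y B), IsPreCosegment n q →
      ∃ (X : C) (f : X ⟶ Y), IsNCokernel n f q)
    (A X : Cᵒᵖ) (p : Path A X) (hp : IsPreSegment n p) :
    ∃ (Y : Cᵒᵖ) (f : X ⟶ Y), IsNKernel n f p := by
  obtain ⟨q, rfl⟩ := exists_opPath_eq p
  obtain ⟨Y, f, hf⟩ := H _ _ q
    ⟨(length_opPath q).symm.trans hp.1, (homToLeftExact_opPath_iff q).1 hp.2⟩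
  refine ⟨Opposite.op Y, f.op, hp.1, ?_⟩
  rw [← opPath_toPath_comp]
  exact (homToLeftExact_opPath_iff _).2 hf.2

end Main

end HigherHomological

open HigherHomological in
theorem theorem11 (C : Type u) [Category.{v} C] [Preadditive C] [HasZeroObject C]
    [HasFiniteBiproducts C] [IsIdempotentComplete C] (n : ℕ) (hn : 1 ≤ n) :
    HigherHomological.IsNAbelian C n ↔
      HigherHomological.HasNKernels C n ∧
      HigherHomological.HasNCokernels C n ∧
      (∀ (A X : C) (p : Quiver.Path A X), HigherHomological.IsPreSegment n p →
        ∃ (Y : C) (f : X ⟶ Y), HigherHomological.IsNKernel n f p) ∧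
      (∀ (Y B : C) (q : Quiver.Path Y B), HigherHomological.IsPreCosegment n q →
        ∃ (X : C) (f : X ⟶ Y), HigherHomological.IsNCokernel n f q) := by
  have : HasBinaryBiproducts C := hasBinaryBiproducts_of_finite_biproducts C
  constructor
  · intro h
    refine ⟨h.hasNKernels, h.hasNCokernels, fun A X p hp => ?_, fun Y B q hq => ?_⟩
    · exact exists_isNKernel_of_isPreSegment n (fun _ _ f hf => h.hasBiexactContinuation hn f hf)
        p hp
    · obtain ⟨X, f, hf⟩ := exists_isNKernel_of_isPreSegment n
        (fun _ _ f hf => h.hasBiexactContinuation_op hn f hf) (opPath q)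
        ⟨(length_opPath q).trans hq.1, (homToLeftExact_opPath_iff q).2 hq.2⟩
      refine ⟨X.unop, f.unop, hq.1, (homToLeftExact_opPath_iff _).1 ?_⟩
      rw [opPath_toPath_comp]
      exact hf.2
  · rintro ⟨hK, hC, hS, hS'⟩
    refine ⟨inferInstance, inferInstance, inferInstance, hK, hC, ?_, ?_⟩
    · intro X Y f hf Z B q g hq
      have hl : q.length + 1 = n := hq.1
      refine ⟨?_, homToLeftExact_of_mono n hS f hf (q.cons g) hl.le hq.2.homFromInnerExact⟩
      rw [Quiver.Path.length_comp, Quiver.Path.length_toPath, Nat.add_comm, hl]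
    · intro X Y f hf A Z g p hp
      have hl := hp.1
      refine ⟨?_, ?_⟩
      · rw [← hl, Quiver.Path.length_comp, Quiver.Path.length_toPath, Quiver.Path.length_cons,
          Nat.add_comm]
      · refine (homToLeftExact_opPath_iff
          (((Quiver.Hom.toPath g).comp p).cons f)).1 ?_
        exact homToLeftExact_of_mono n (exists_isNKernel_op hS') f.op inferInstance
          (opPath ((Quiver.Hom.toPath g).comp p)) ((length_opPath _).trans hl).le
          (homFromInnerExact_opPath (((Quiver.Hom.toPath g).comp p).cons f) hp.2)
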